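/- Let $\Sigma$ be a finite alphabet, let $L\subseteq\Sigma^*$ be an arbitrary language (not necessarily computable), and let $0<\varepsilon<\tfrac12$. Then $L$ has a weak interactive proof system $(P,V)$ with error bound $\varepsilon$ whose verifier $V$ is a sweeping probabilistic finite automaton. Here $V$ is a two-way probabilistic finite automaton, with arbitrary real transition probabilities and without a work tape, reading the input between two end-markers and equipped with a one-symbol communication cell over a finite alphabet $\Upsilon$. Its finite state set is partitioned into reading states (one of them initial), communicating states, an accepting and a rejecting halting state. In a reading state, the next state and the head move (left, stay, right) are chosen at random, with probabilities depending on the state and the symbol under the head, which never leaves the part of the tape delimited by the end-markers; in a communicating state $s$, $V$ writes a symbol $\tau_s\in\Upsilon$, the prover replies with some $\tau\in\Upsilon$, and the next state is determined by $s$ and $\tau$. The computation ends when a halting state is entered. $V$ is sweeping if the direction of the input head can change only on the end-markers. A prover is an arbitrary function giving its reply from the input and the sequence of symbols written by $V$ so far; it does not see the random choices of $V$. The pair $(P,V)$ is a weak interactive proof system for $L$ with error bound $\varepsilon$ if 1. every $x\in L$ is accepted by $V$ with probability at least $1-\varepsilon$ when communicating with $P$; and 2. every $x\in\Sigma^*\setminus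 L$ is accepted by $V$ with probability at most $\varepsilon$ when communicating with any prover $P^*$. (In particular, non-members need not be rejected with high probability: the computation may run forever.) -/

import Mathlib

open scoped ENNReal

namespace WeakIPS

/-- The content of a cell of the input tape: a letter or one of the two end-markers. -/
inductive TapeSymbol (α : Type*) where
  | leftEnd : TapeSymbol α
  | letter : α → TapeSymbol α
  | rightEnd : TapeSymbol α

/-- The possible moves of the input head (`stay`: the head does not move). -/
inductive Move where
  | left : Move
  | stay : Move
  | right : Move

/-- The states of a verifier, partitioned into reading states, communicating states and the two
halting states (accepting and rejecting). -/
inductive State (R C : Type) where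
  | read : R → State R C
  | comm : C → State R C
  | accept : State R C
  | reject : State R C

/-- A constant-space verifier with input alphabet `α`: a two-way probabilistic finite automaton
(no work tape) with a communication cell. Transition probabilities are arbitrary reals. -/
structure Verifier (α : Type*) where
  /-- the reading states -/
  R : Type
  /-- the communicating states -/
  C : Type
  /-- the communication alphabet -/
  Msg : Type
  finite_R : Finite R
  finite_C : Finite C
  finite_Msg : Finite Msg
  /-- the initial state, a reading state -/
  start : R
  /-- in a reading state: the distribution of the next state and of the move of the head, given
  the symbol under the head -/
  deltaRead : R → TapeSymbol α → PMF (State R C × Move)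
  /-- the symbol that a communicating state writes on the communication cell -/
  write : C → Msg
  /-- in a communicating state: the next state, given the reply of the prover -/
  deltaComm : C → Msg → State R C
  /-- the head never moves to the left of the left end-marker -/
  not_left : ∀ r s, deltaRead r TapeSymbol.leftEnd (s, Move.left) = 0
  /-- the head never moves to the right of the right end-marker -/
  not_right : ∀ r s, deltaRead r TapeSymbol.rightEnd (s, Move.right) = 0

/-- The input tape of `w`: cell `0` holds the left end-marker, cells `1, …, |w|` hold `w`, and
cell `|w| + 1` holds the right end-marker (cells further to the right are never visited). -/
def tape {α : Type*} (w : List α) : ℕ → TapeSymbol α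
  | 0 => TapeSymbol.leftEnd
  | i + 1 =>
    match w[i]? with
    | some a => TapeSymbol.letter a
    | none => TapeSymbol.rightEnd

/-- The new position of the head. -/
def Move.apply : Move → ℕ → ℕ
  | Move.left, i => i - 1
  | Move.stay, i => i
  | Move.right, i => i + 1

namespace Verifier

variable {α : Type*}

/-- A prover that may communicate with `V`: it replies as an arbitrary function of the input and
of the sequence of all the symbols written by the verifier so far (the last one included). It sees
neither the states, nor the head, nor the random choices of the verifier. -/
def Prover (V : Verifier α) : Type _ := List α → List V.Msg → V.Msg

/-- A configuration: the state, the position of the input head, and the symbols written on the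
communication cell by the verifier so far. -/
structure Config (V : Verifier α) where
  state : State V.R V.C
  pos : ℕ
  sent : List V.Msg

/-- The initial configuration. -/
def init (V : Verifier α) : V.Config := ⟨State.read V.start, 0, []⟩

/-- The distribution of the next configuration on input `w` with prover `P`. Halting
configurations are absorbing. -/
noncomputable def step (V : Verifier α) (P : V.Prover) (w : List α) : V.Config → PMF V.Config
  | ⟨State.read r, i, h⟩ =>
      (V.deltaRead r (tape w i)).map fun x => ⟨x.1, x.2.apply i, h⟩
  | ⟨State.comm c, i, h⟩ =>
      PMF.pure ⟨V.deltaComm c (P w (h ++ [V.write c])), i, h ++ [V.write c]⟩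
  | ⟨State.accept, i, h⟩ => PMF.pure ⟨State.accept, i, h⟩
  | ⟨State.reject, i, h⟩ => PMF.pure ⟨State.reject, i, h⟩

/-- The distribution of the configuration after `t` steps, starting from a given configuration. -/
noncomputable def run (V : Verifier α) (P : V.Prover) (w : List α) : ℕ → V.Config → PMF V.Config
  | 0, c => PMF.pure c
  | t + 1, c => (V.step P w c).bind (V.run P w t)

/-- The probability that `V` accepts `w` when communicating with `P`: the supremum (limit) over
`t` of the probability of being in the accepting state after `t` steps. -/
noncomputable def acceptProb (V : Verifier α) (P : V.Prover) (w : List α) : ℝ≥0∞ :=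
  ⨆ t : ℕ, ((V.run P w t V.init).map Config.state) State.accept

/-- `V.Reach w s i d`: on input `w`, for some replies of the prover and with positive probability,
`V` comes to state `s` with the head at position `i`, and `d` is the direction of the last
non-stationary move (`right` if the head has not moved yet). -/
inductive Reach (V : Verifier α) (w : List α) : State V.R V.C → ℕ → Move → Prop
  | init : Reach V w (State.read V.start) 0 Move.right
  | comm {c : V.C} {i : ℕ} {d : Move} (m : V.Msg) :
      Reach V w (State.comm c) i d → Reach V w (V.deltaComm c m) i d
  | stay {r : V.R} {i : ℕ} {d : Move} {s : State V.R V.C} :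
      Reach V w (State.read r) i d → V.deltaRead r (tape w i) (s, Move.stay) ≠ 0 →
      Reach V w s i d
  | move {r : V.R} {i : ℕ} {d m : Move} {s : State V.R V.C} :
      Reach V w (State.read r) i d → m ≠ Move.stay → V.deltaRead r (tape w i) (s, m) ≠ 0 →
      Reach V w s (m.apply i) m

/-- `V` is sweeping: on every input, whatever the prover replies, the direction of the input head
is changed only on the end-markers. -/
def IsSweeping (V : Verifier α) : Prop :=
  ∀ (w : List α) (r : V.R) (i : ℕ) (d m : Move) (s : State V.R V.C),
    V.Reach w (State.read r) i d → V.deltaRead r (tape w i) (s, m) ≠ 0 →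
    m ≠ Move.stay → m ≠ d → i = 0 ∨ i = w.length + 1

/-- `(P, V)` is a weak interactive proof system for `L` with error bound `ε`: `V` accepts every
member with probability at least `1 - ε` when communicating with `P`, and accepts every non-member
with probability at most `ε` when communicating with any prover. -/
def IsWeakIPS (V : Verifier α) (P : V.Prover) (L : Language α) (ε : ℝ) : Prop :=
  (∀ x ∈ L, ENNReal.ofReal (1 - ε) ≤ V.acceptProb P x) ∧
  (∀ x ∉ L, ∀ P' : V.Prover, V.acceptProb P' x ≤ ENNReal.ofReal ε)

end Verifier

end WeakIPS

/-!
Number the words by `w ↦ k w`, and let `p` be the real number whose `k`-th digit after the octal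
point is `1` if `k` numbers a member of `L`, and `0` otherwise (digits counted from `0`). Then
`p * 8 ^ (k w + 1)` is within `1 / 4` of an odd number if `w ∈ L`, and at distance at least `3 / 4`
from all odd numbers if not. An honest prover sends in unary the numerals leading to `k w`, then the
powers of `8` leading to `8 ^ (k w + 1)`, and finally the nearest odd number. The verifier has to
test that some real linear expressions in the lengths of the blocks of the message are small.

It does so with odds in place of counters. In a fraction `mix` of the rounds it intends to accept,
and in the others it gives each test a random sign `s` and intends to reject. Whenever a discrepancy
changes by `e`, it keeps its intention with probability `exp (-lam * |e|)` in the former case and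
`exp (-lam * (|e| + s * e))` in the latter. Both lose the same factor over a round, except that a
test with final discrepancy `x` multiplies the odds of rejection, averaged over its sign, by
`cosh (lam * x)`. This is at least `1`, so an error in one test cannot be compensated by another.
With `lam` large and `mix` suitable, the odds favour acceptance when all discrepancies vanish except
one of size at most `1 / 4`, and rejection when some discrepancy is at least `3 / 4`. A round that
loses its intention is repeated, which does not change the odds.
-/

namespace WeakIPS

/-- The toss of a coin that shows `true` with probability `p`, truncated to `[0, 1]`. -/
noncomputable def coin (p : ℝ) : PMF Bool :=
  PMF.ofFintype (fun b => cond b (min (ENNReal.ofReal p) 1) (1 - min (ENNReal.ofReal p) 1))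
    (by simp)

namespace Verifier

variable {α : Type*} (V : Verifier α) (P : V.Prover) (w : List α)

/-- The probability, as a real number, of being in the accepting state after `t` steps from a
random configuration with law `μ`. -/
noncomputable def accFrom (t : ℕ) (μ : PMF V.Config) : ℝ :=
  (((μ.bind (V.run P w t)).map Config.state) State.accept).toReal

lemma accFrom_nonneg (t : ℕ) (μ : PMF V.Config) : 0 ≤ V.accFrom P w t μ :=
  ENNReal.toReal_nonneg

lemma accFrom_bind {β : Type*} [Fintype β] (t : ℕ) (μ : PMF β) (f : β → PMF V.Config) :
    V.accFrom P w t (μ.bind f) = ∑ b, (μ b).toReal * V.accFrom P w t (f b) := by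
  simp only [accFrom, PMF.bind_bind, PMF.map_bind]
  rw [PMF.bind_apply, tsum_fintype,
    ENNReal.toReal_sum fun b _ => ENNReal.mul_ne_top (μ.apply_ne_top b) (PMF.apply_ne_top _ _)]
  simp only [ENNReal.toReal_mul]

lemma accFrom_coin {p : ℝ} (hp : p ∈ Set.Icc 0 1) (t : ℕ) (f : Bool → PMF V.Config) :
    V.accFrom P w t ((coin p).bind f) =
      p * V.accFrom P w t (f true) + (1 - p) * V.accFrom P w t (f false) := by
  have h : ENNReal.ofReal p ≤ 1 := by simpa using hp.2
  rw [accFrom_bind, Fintype.sum_bool]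
  simp only [coin, PMF.ofFintype_apply, cond_true, cond_false, min_eq_left h]
  rw [ENNReal.toReal_ofReal hp.1, ENNReal.toReal_sub_of_le h ENNReal.one_ne_top,
    ENNReal.toReal_ofReal hp.1, ENNReal.toReal_one]

lemma accFrom_uniform {β : Type*} [Fintype β] [Nonempty β] (t : ℕ) (f : β → PMF V.Config) :
    V.accFrom P w t ((PMF.uniformOfFintype β).bind f) =
      (∑ b, V.accFrom P w t (f b)) / Fintype.card β := by
  simp [accFrom_bind, div_eq_inv_mul, Finset.mul_sum]

lemma accFrom_succ (t : ℕ) (c : V.Config) :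
    V.accFrom P w (t + 1) (PMF.pure c) = V.accFrom P w t (V.step P w c) := by
  simp only [accFrom, PMF.pure_bind, run]

lemma accFrom_zero {c : V.Config} (h : c.state ≠ State.accept) :
    V.accFrom P w 0 (PMF.pure c) = 0 := by
  simp [accFrom, run, PMF.pure_map, h.symm]

lemma accFrom_accept (t i : ℕ) (h : List V.Msg) :
    V.accFrom P w t (PMF.pure ⟨State.accept, i, h⟩) = 1 := by
  induction t with
  | zero => simp [accFrom, run, PMF.pure_map]
  | succ t ih => rw [accFrom_succ]; exact ih

lemma accFrom_reject (t i : ℕ) (h : List V.Msg) :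
    V.accFrom P w t (PMF.pure ⟨State.reject, i, h⟩) = 0 := by
  induction t with
  | zero => simp [accFrom, run, PMF.pure_map]
  | succ t ih => rw [accFrom_succ]; exact ih

lemma ofReal_accFrom_init (t : ℕ) : ENNReal.ofReal (V.accFrom P w t (PMF.pure V.init)) =
    ((V.run P w t V.init).map Config.state) State.accept := by
  rw [accFrom, PMF.pure_bind, ENNReal.ofReal_toReal (PMF.apply_ne_top _ _)]

lemma acceptProb_le_ofReal {ε : ℝ} (hε : ∀ t, V.accFrom P w t (PMF.pure V.init) ≤ ε) :
    V.acceptProb P w ≤ ENNReal.ofReal ε :=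
  iSup_le fun t => V.ofReal_accFrom_init P w t ▸ ENNReal.ofReal_le_ofReal (hε t)

lemma ofReal_le_acceptProb {δ : ℝ}
    (hδ : ∀ b < δ, ∃ t, b ≤ V.accFrom P w t (PMF.pure V.init)) :
    ENNReal.ofReal δ ≤ V.acceptProb P w := by
  refine le_of_forall_lt fun b hb => ?_
  obtain ⟨b', hb₀, hbb', hb'⟩ := ENNReal.lt_iff_exists_real_btwn.1 hb
  obtain ⟨t, ht⟩ := hδ b' ((ENNReal.ofReal_lt_ofReal_iff_of_nonneg hb₀).1 hb')
  calc b < ENNReal.ofReal b' := hbb'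
    _ ≤ ENNReal.ofReal (V.accFrom P w t (PMF.pure V.init)) := ENNReal.ofReal_le_ofReal ht
    _ ≤ V.acceptProb P w :=
        V.ofReal_accFrom_init P w t ▸
          le_iSup (fun t => ((V.run P w t V.init).map Config.state) State.accept) t

end Verifier

/-- Moves a triple one test on: the current test is dropped, the next test becomes current, `x`
belongs to the newly opened next test, and the third test is kept. -/
def rotate {X : Type*} (x : X) (d : X × X × X) : X × X × X := (d.2.1, x, d.2.2)

/-- The `ℓ¹` norm of a triple of discrepancies (the norm of `ℝ × ℝ × ℝ` is the maximum). -/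
def absSum (e : ℝ × ℝ × ℝ) : ℝ := |e.1| + |e.2.1| + |e.2.2|

lemma absSum_nonneg (e : ℝ × ℝ × ℝ) : 0 ≤ absSum e := by
  unfold absSum; positivity

lemma absSum_add_le (d e : ℝ × ℝ × ℝ) : absSum (d + e) ≤ absSum d + absSum e := by
  simp only [absSum, Prod.fst_add, Prod.snd_add]
  linarith [abs_add_le d.1 e.1, abs_add_le d.2.1 e.2.1, abs_add_le d.2.2 e.2.2]

/-- The sign `± 1` encoded by a Boolean. -/
def sgn (b : Bool) : ℝ := cond b 1 (-1)

/-- The sum of a triple of discrepancies, taken with given signs. -/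
def signedSum (s : Bool × Bool × Bool) (e : ℝ × ℝ × ℝ) : ℝ :=
  sgn s.1 * e.1 + sgn s.2.1 * e.2.1 + sgn s.2.2 * e.2.2

lemma signedSum_add (s : Bool × Bool × Bool) (d e : ℝ × ℝ × ℝ) :
    signedSum s (d + e) = signedSum s d + signedSum s e := by
  simp only [signedSum, Prod.fst_add, Prod.snd_add]
  ring

lemma abs_add_sgn_mul_nonneg (b : Bool) (x : ℝ) : 0 ≤ |x| + sgn b * x := by
  cases b
  · simpa [sgn] using le_abs_self x
  · simpa [sgn, neg_le_iff_add_nonneg'] using neg_abs_le x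

lemma absSum_add_signedSum_nonneg (s : Bool × Bool × Bool) (e : ℝ × ℝ × ℝ) :
    0 ≤ absSum e + signedSum s e := by
  simp only [absSum, signedSum]
  linarith [abs_add_sgn_mul_nonneg s.1 e.1, abs_add_sgn_mul_nonneg s.2.1 e.2.1,
    abs_add_sgn_mul_nonneg s.2.2 e.2.2]

lemma sum_exp_signedSum (c : ℝ) (d : ℝ × ℝ × ℝ) :
    ∑ s, Real.exp (-(c * signedSum s d)) =
      8 * (Real.cosh (c * d.1) * Real.cosh (c * d.2.1) * Real.cosh (c * d.2.2)) := by
  simp only [Fintype.sum_prod_type, Fintype.sum_bool, signedSum, sgn, cond_true, cond_false,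
    Real.cosh_eq, one_mul, neg_mul, mul_add, neg_add, mul_neg, neg_neg, Real.exp_add]
  ring

lemma one_le_prod_cosh (l : List ℝ) : 1 ≤ (l.map Real.cosh).prod := by
  induction l with
  | nil => simp
  | cons x l ih => simpa using one_le_mul_of_one_le_of_one_le (Real.one_le_cosh x) ih

lemma cosh_le_prod_cosh {x : ℝ} {l : List ℝ} (hx : x ∈ l) :
    Real.cosh x ≤ (l.map Real.cosh).prod := by
  rw [((List.perm_cons_erase hx).map _).prod_eq, List.map_cons, List.prod_cons]
  exact le_mul_of_one_le_right (Real.cosh_pos x).le (one_le_prod_cosh _)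

lemma cosh_le_exp_abs (x : ℝ) : Real.cosh x ≤ Real.exp |x| := by
  rw [← Real.cosh_abs, Real.cosh_eq]
  linarith [Real.exp_le_exp.2 (neg_le_self (abs_nonneg x))]

lemma exp_abs_le_two_mul_cosh (x : ℝ) : Real.exp |x| ≤ 2 * Real.cosh x := by
  rw [← Real.cosh_abs, Real.cosh_eq]
  linarith [Real.exp_pos (-|x|)]

lemma prod_cosh_le_exp_sum_abs (l : List ℝ) :
    (l.map Real.cosh).prod ≤ Real.exp (l.map fun x => |x|).sum := by
  induction l with
  | nil => simp
  | cons x l ih =>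
    simp only [List.map_cons, List.prod_cons, List.sum_cons, Real.exp_add]
    exact mul_le_mul (cosh_le_exp_abs x) ih (zero_le_one.trans (one_le_prod_cosh l))
      (Real.exp_nonneg _)

lemma tape_eq_leftEnd {α : Type*} {w : List α} {i : ℕ} : tape w i = .leftEnd ↔ i = 0 := by
  rcases i with _ | i
  · simp [tape]
  · rcases h : w[i]? with _ | a <;> simp [tape, h]

lemma tape_eq_rightEnd {α : Type*} {w : List α} {i : ℕ} :
    tape w i = .rightEnd ↔ w.length + 1 ≤ i := by
  rcases i with _ | i
  · simp [tape]
  · rw [Nat.add_le_add_iff_right, ← List.getElem?_eq_none_iff]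
    rcases h : w[i]? with _ | a <;> simp [tape, h]

lemma tape_length_add_one {α : Type*} (w : List α) : tape w (w.length + 1) = .rightEnd :=
  tape_eq_rightEnd.2 le_rfl

lemma tape_succ_of_lt {α : Type*} {w : List α} {j : ℕ} (hj : j < w.length) :
    tape w (j + 1) = .letter w[j] := by
  simp [tape, hj]

/-- Reaction of a protocol to a message: `trap` rejects forever, `finish` ends the round, and
`go q mv close e` continues in phase `q` after the move `mv`, adding `e` to the discrepancies of
the three running tests; the first of them is completed if `close` holds. -/
inductive Action (Q : Type) where
  | trap
  | finish
  | go (q : Q) (mv : Move) (close : Bool) (e : ℝ × ℝ × ℝ)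

/-- The deterministic part of a verifier. A message of the prover is processed letter by letter in
rounds, each of which sweeps the input from left to right and tests that certain real linear
expressions in the lengths of the blocks of the message vanish (their values are the
discrepancies). `Q` is the set of phases of a round and `M` the communication alphabet. -/
structure Protocol (α : Type*) (Q M : Type) where
  start : Q
  action : Q → M → TapeSymbol α → Action Q
  eq_rightEnd_of_finish : ∀ {q m σ}, action q m σ = .finish → σ = .rightEnd
  move_of_go : ∀ {q m σ q' mv close e}, action q m σ = .go q' mv close e →
    mv = .stay ∨ mv = .right ∧ ∃ a, σ = .letter a

/-- The hidden mode of a round: it is going to accept, to reject, or (`void`) to have no effect.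
In a rejecting round each running test carries a random sign. -/
inductive Mode where
  | void
  | accepting
  | rejecting (s : Bool × Bool × Bool)
  deriving Fintype

/-- The numerical parameters of a verifier: a change of a discrepancy by `x` is survived with a
probability whose logarithm is proportional to `lam * x`, and a round starts in the accepting mode
with probability `mix`. -/
structure Rates where
  lam : ℝ
  mix : ℝ
  lam_nonneg : 0 ≤ lam
  mix_pos : 0 < mix
  mix_le_one : mix ≤ 1

namespace Rates

variable (r : Rates)

lemma mix_mem_Icc : r.mix ∈ Set.Icc 0 1 := ⟨r.mix_pos.le, r.mix_le_one⟩

lemma exp_neg_lam_mul_mem_Icc {x : ℝ} (hx : 0 ≤ x) :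
    Real.exp (-(r.lam * x)) ∈ Set.Icc 0 1 :=
  ⟨Real.exp_nonneg _, Real.exp_le_one_iff.2 (neg_nonpos.2 (mul_nonneg r.lam_nonneg hx))⟩

/-- The law of the mode after the discrepancies have changed by `e`. The survival probabilities
depend on `e` through the exponential, so that over a whole round only the final discrepancies
matter. -/
noncomputable def hop (close : Bool) (e : ℝ × ℝ × ℝ) : Mode → PMF Mode
  | .void => PMF.pure .void
  | .accepting => (coin (Real.exp (-(r.lam * absSum e)))).bind fun z =>
      PMF.pure (if z then .accepting else .void)
  | .rejecting s => (coin (Real.exp (-(r.lam * (absSum e + signedSum s e))))).bind fun z =>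
      if z then
        (coin (1 / 2)).bind fun b => PMF.pure (.rejecting (if close then rotate b s else s))
      else PMF.pure .void

/-- The law of the mode at the beginning of a round. -/
noncomputable def sample : PMF Mode :=
  (coin r.mix).bind fun z => if z then PMF.pure .accepting else
    (PMF.uniformOfFintype (Bool × Bool × Bool)).bind fun s => PMF.pure (.rejecting s)

end Rates

/-- The reading states of the verifier of a protocol: `none` returns to the left end-marker, and
`some (q, η, m)` processes the message `m` in phase `q` and mode `η`. -/
abbrev Reading (Q M : Type) := Option (Q × Mode × M)

namespace Protocol

variable {α : Type*} {Q M : Type}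

/-- The state entered at the end of a round. -/
def verdict : Mode → State (Reading Q M) (Q × Mode)
  | .void => .read none
  | .accepting => .accept
  | .rejecting _ => .reject

/-- The law of the next state and head move, given the reaction of the protocol. -/
noncomputable def react (r : Rates) (η : Mode) :
    Action Q → PMF (State (Reading Q M) (Q × Mode) × Move)
  | .trap => PMF.pure (.reject, .stay)
  | .finish => PMF.pure (verdict η, .stay)
  | .go q mv close e => (r.hop close e η).map fun η' => (.comm (q, η'), mv)

variable (A : Protocol α Q M) (r : Rates)

/-- The transition function of the verifier of a protocol. -/
noncomputable def delta :
    Reading Q M → TapeSymbol α → PMF (State (Reading Q M) (Q × Mode) × Move)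
  | none, .leftEnd => r.sample.map fun η => (.comm (A.start, η), .right)
  | none, _ => PMF.pure (.read none, .left)
  | some (q, η, m), σ => react r η (A.action q m σ)

variable {A r}

lemma delta_none_ne_zero {σ : TapeSymbol α} {s mv} (h : A.delta r none σ (s, mv) ≠ 0) :
    (σ = .leftEnd ∧ mv = .right ∧ ∃ η, s = .comm (A.start, η)) ∨
      (σ ≠ .leftEnd ∧ mv = .left ∧ s = .read none) := by
  rw [← PMF.mem_support_iff] at h
  cases σ
  · simp only [delta, PMF.support_map, Set.mem_image, Prod.mk.injEq] at h
    obtain ⟨η, -, rfl, rfl⟩ := h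
    exact .inl ⟨rfl, rfl, η, rfl⟩
  all_goals simp_all [delta]

lemma delta_some_ne_zero {q η m s mv} {σ : TapeSymbol α}
    (h : A.delta r (some (q, η, m)) σ (s, mv) ≠ 0) :
    (mv = .stay ∧ s = .reject) ∨ (mv = .stay ∧ σ = .rightEnd ∧ s = verdict η) ∨
      (mv = .stay ∨ mv = .right ∧ ∃ a, σ = .letter a) ∧ ∃ c, s = .comm c := by
  rw [← PMF.mem_support_iff, delta] at h
  rcases hA : A.action q m σ with _ | _ | ⟨q', mv', close, e⟩ <;> rw [hA] at h
  · simp_all [react]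
  · simp_all [react, A.eq_rightEnd_of_finish hA]
  · simp only [react, PMF.support_map, Set.mem_image, Prod.mk.injEq] at h
    obtain ⟨η', -, rfl, rfl⟩ := h
    exact .inr (.inr ⟨A.move_of_go hA, _, rfl⟩)

lemma delta_leftEnd_left (c : Reading Q M) (s) : A.delta r c .leftEnd (s, .left) = 0 := by
  by_contra h
  rcases c with _ | ⟨q, η, m⟩
  · simpa using delta_none_ne_zero h
  · simpa using delta_some_ne_zero h

lemma delta_rightEnd_right (c : Reading Q M) (s) : A.delta r c .rightEnd (s, .right) = 0 := by
  by_contra h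
  rcases c with _ | ⟨q, η, m⟩
  · simpa using delta_none_ne_zero h
  · simpa using delta_some_ne_zero h

/-- The invariant behind the sweeping property, where `n` is the length of the input: the head only
moves right during a round, and a round ends on the right end-marker. -/
def SweepInv (n : ℕ) : State (Reading Q M) (Q × Mode) → ℕ → Move → Prop
  | .read none, i, d => i = 0 ∨ i = n + 1 ∨ d = .left
  | .read (some _), i, d | .comm _, i, d => i ≤ n + 1 ∧ d = .right
  | .accept, _, _ | .reject, _, _ => True

/-- The direction of the last non-stationary move after the move `mv`. -/
def turn (d : Move) : Move → Move
  | .stay => d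
  | mv => mv

lemma SweepInv.delta {w : List α} {c : Reading Q M} {i d s mv}
    (hc : SweepInv w.length (.read c) i d) (h : A.delta r c (tape w i) (s, mv) ≠ 0) :
    SweepInv w.length s (mv.apply i) (turn d mv) := by
  rcases c with _ | ⟨q, η, m⟩
  · rcases delta_none_ne_zero h with ⟨hσ, rfl, η, rfl⟩ | ⟨-, rfl, rfl⟩
    · obtain rfl := tape_eq_leftEnd.1 hσ
      exact ⟨Nat.le_add_left 1 _, rfl⟩
    · exact .inr (.inr rfl)
  · obtain ⟨hi, rfl⟩ := hc
    rcases delta_some_ne_zero h with ⟨rfl, rfl⟩ | ⟨rfl, hσ, rfl⟩ | ⟨rfl | ⟨rfl, a, hσ⟩, c, rfl⟩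
    · trivial
    · obtain rfl : i = w.length + 1 := le_antisymm hi (tape_eq_rightEnd.1 hσ)
      cases η
      exacts [.inr (.inl rfl), trivial, trivial]
    · exact ⟨hi, rfl⟩
    · have : ¬ w.length + 1 ≤ i := by rw [← tape_eq_rightEnd, hσ]; nofun
      exact ⟨by simp only [Move.apply]; omega, rfl⟩

variable (A r) [Finite Q] [Finite M] [Inhabited M]

/-- The verifier of a protocol: it always writes the same symbol, and repeats rounds until one of
them ends in an accepting or rejecting mode. -/
noncomputable def verifier : Verifier α where
  R := Reading Q M
  C := Q × Mode
  Msg := M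
  finite_R := inferInstance
  finite_C := inferInstance
  finite_Msg := inferInstance
  start := none
  deltaRead := A.delta r
  write _ := default
  deltaComm c m := .read (some (c.1, c.2, m))
  not_left := delta_leftEnd_left
  not_right := delta_rightEnd_right

variable {A r}

lemma sweepInv_of_reach {w : List α} {s i d} (h : (A.verifier r).Reach w s i d) :
    SweepInv w.length s i d := by
  induction h with
  | init => exact .inl rfl
  | comm _ _ ih => exact ih
  | stay _ h ih => exact ih.delta h
  | @move _ _ _ mv _ _ hmv h ih =>
    have := ih.delta h
    cases mv
    exacts [this, absurd rfl hmv, this]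

theorem isSweeping_verifier : (A.verifier r).IsSweeping := by
  intro w c i d mv s h hδ hmv hd
  have hinv : SweepInv w.length (.read c) i d := sweepInv_of_reach h
  rcases c with _ | ⟨q, η, m⟩
  · rcases hinv with hi | hi | rfl
    · exact .inl hi
    · exact .inr hi
    · rcases delta_none_ne_zero hδ with ⟨hσ, -, -⟩ | ⟨-, rfl, -⟩
      · exact .inl (tape_eq_leftEnd.1 hσ)
      · exact absurd rfl hd
  · obtain ⟨-, rfl⟩ := hinv
    rcases delta_some_ne_zero hδ with ⟨rfl, -⟩ | ⟨rfl, -⟩ | ⟨rfl | ⟨rfl, -⟩, -⟩ <;>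
      exact absurd rfl ‹_›

end Protocol

namespace Rates

variable (r : Rates)

/-- The expectation of a function of the mode after a hop. -/
noncomputable def average (close : Bool) (e : ℝ × ℝ × ℝ) (f : Mode → ℝ) : Mode → ℝ
  | .void => f .void
  | .accepting => f .void + Real.exp (-(r.lam * absSum e)) * (f .accepting - f .void)
  | .rejecting s => f .void + Real.exp (-(r.lam * (absSum e + signedSum s e))) *
      ((f (.rejecting (if close then rotate true s else s)) +
        f (.rejecting (if close then rotate false s else s))) / 2 - f .void)

lemma accFrom_hop {α : Type*} (V : Verifier α) (P : V.Prover) (w : List α) (t : ℕ) (close : Bool)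
    (e : ℝ × ℝ × ℝ) (g : Mode → V.Config) (η : Mode) :
    V.accFrom P w t ((r.hop close e η).map g) =
      r.average close e (fun η' => V.accFrom P w t (PMF.pure (g η'))) η := by
  rcases η with _ | _ | s
  · simp only [hop, average, PMF.pure_map]
  · rw [hop, PMF.map_bind, V.accFrom_coin P w (r.exp_neg_lam_mul_mem_Icc (absSum_nonneg e))]
    simp only [average, if_true, Bool.false_eq_true, if_false, PMF.pure_map]
    ring
  · rw [hop, PMF.map_bind,
      V.accFrom_coin P w (r.exp_neg_lam_mul_mem_Icc (absSum_add_signedSum_nonneg s e))]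
    simp only [average, if_true, Bool.false_eq_true, if_false, PMF.pure_map, PMF.map_bind]
    rw [V.accFrom_coin P w (by norm_num)]
    ring

lemma accFrom_sample {α : Type*} (V : Verifier α) (P : V.Prover) (w : List α) (t : ℕ)
    (g : Mode → V.Config) :
    V.accFrom P w t (r.sample.map g) = r.mix * V.accFrom P w t (PMF.pure (g .accepting)) +
      (1 - r.mix) / 8 * ∑ s, V.accFrom P w t (PMF.pure (g (.rejecting s))) := by
  rw [sample, PMF.map_bind, V.accFrom_coin P w r.mix_mem_Icc]
  simp only [if_true, Bool.false_eq_true, if_false, PMF.map_bind, PMF.pure_map]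
  rw [V.accFrom_uniform]
  simp only [Fintype.card_prod, Fintype.card_bool]
  push_cast
  ring

end Rates

/-- The public state of a round: the phase, the position of the head, the discrepancies `d` of the
three running tests, the total `ℓ¹` variation of the discrepancies so far, and the final
discrepancies of the completed tests. -/
structure Ledger (Q : Type) where
  q : Q
  i : ℕ
  d : ℝ × ℝ × ℝ
  variation : ℝ
  closed : List ℝ

namespace Ledger

variable {Q : Type} (g : Ledger Q) (r : Rates)

/-- The ledger after the reaction `Action.go q mv close e`. -/
noncomputable def next (q : Q) (mv : Move) (close : Bool) (e : ℝ × ℝ × ℝ) : Ledger Q where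
  q := q
  i := mv.apply g.i
  d := if close then rotate 0 (g.d + e) else g.d + e
  variation := g.variation + absSum e
  closed := if close then (g.d + e).1 :: g.closed else g.closed

/-- The discrepancies of all the tests of a round. -/
def discrepancies : List ℝ := g.d.1 :: g.d.2.1 :: g.d.2.2 :: g.closed

/-- The likelihood ratio of the rejecting against the accepting mode, given that the mode is not
`void`. -/
noncomputable def evidence : ℝ := (g.discrepancies.map fun x => Real.cosh (r.lam * x)).prod

/-- The probability of surviving in the accepting mode. -/
noncomputable def survival : ℝ := Real.exp (-(r.lam * g.variation))

lemma survival_pos : 0 < g.survival r := Real.exp_pos _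

/-- The expectation of a function of the mode, under the law of the mode that the ledger implies.
Given a completed test with discrepancy `x`, averaging over its sign has left the factor
`cosh (lam * x)`. -/
noncomputable def mean (f : Mode → ℝ) : ℝ :=
  f .void + g.survival r * (r.mix * (f .accepting - f .void) +
    (1 - r.mix) / 8 * (g.closed.map fun x => Real.cosh (r.lam * x)).prod *
      ∑ s, Real.exp (-(r.lam * signedSum s g.d)) * (f (.rejecting s) - f .void))

variable {g r}

lemma sum_exp_signedSum_rotate (c : ℝ) (d : ℝ × ℝ × ℝ) (f : Bool × Bool × Bool → ℝ) :
    ∑ s, Real.exp (-(c * signedSum s d)) * ((f (rotate true s) + f (rotate false s)) / 2) =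
      Real.cosh (c * d.1) * ∑ s, Real.exp (-(c * signedSum s (rotate 0 d))) * f s := by
  simp only [Fintype.sum_prod_type, Fintype.sum_bool, signedSum, rotate, sgn, cond_true, cond_false,
    Real.cosh_eq, one_mul, neg_mul, mul_add, neg_add, mul_neg, neg_neg, mul_zero, add_zero,
    Real.exp_add]
  ring

lemma mean_average (f : Mode → ℝ) (q : Q) (mv : Move) (close : Bool) (e : ℝ × ℝ × ℝ) :
    g.mean r (r.average close e f) = (g.next q mv close e).mean r f := by
  have hexp (s : Bool × Bool × Bool) (y : ℝ) : Real.exp (-(r.lam * signedSum s g.d)) *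
      (Real.exp (-(r.lam * (absSum e + signedSum s e))) * y) =
      Real.exp (-(r.lam * absSum e)) * (Real.exp (-(r.lam * signedSum s (g.d + e))) * y) := by
    rw [signedSum_add, ← mul_assoc, ← mul_assoc, ← Real.exp_add, ← Real.exp_add]
    ring_nf
  have hsurv : (g.next q mv close e).survival r =
      g.survival r * Real.exp (-(r.lam * absSum e)) := by
    rw [survival, survival, next, mul_add, neg_add, Real.exp_add]
  simp only [mean, Rates.average, add_sub_cancel_left, hexp, ← Finset.mul_sum, hsurv]
  cases close
  · simp only [next, Bool.false_eq_true, if_false, add_self_div_two]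
    ring
  · have hrot := sum_exp_signedSum_rotate r.lam (g.d + e)
      fun s => f (.rejecting s) - f .void
    have hmid (a b z : ℝ) : (a - z + (b - z)) / 2 = (a + b) / 2 - z := by ring
    simp only [hmid] at hrot
    simp only [next, if_true, hrot, List.map_cons, List.prod_cons]
    ring

lemma mean_zero : g.mean r (fun _ => 0) = 0 := by
  simp [mean]

variable (g r) in
/-- The probability that a round with the final ledger `g` accepts. -/
noncomputable def probAccept : ℝ := g.survival r * r.mix

variable (g r) in
/-- The probability that a round with the final ledger `g` rejects. -/
noncomputable def probReject : ℝ := g.survival r * ((1 - r.mix) * g.evidence r)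

lemma probAccept_pos : 0 < g.probAccept r := mul_pos (g.survival_pos r) r.mix_pos

lemma one_le_evidence : 1 ≤ g.evidence r := by
  simpa [evidence, Function.comp_def] using one_le_prod_cosh (g.discrepancies.map (r.lam * ·))

lemma cosh_le_evidence {x : ℝ} (hx : x ∈ g.discrepancies) :
    Real.cosh (r.lam * x) ≤ g.evidence r := by
  simpa [evidence, Function.comp_def] using
    cosh_le_prod_cosh (List.mem_map_of_mem (f := (r.lam * ·)) hx)

lemma probReject_nonneg : 0 ≤ g.probReject r :=
  mul_nonneg (g.survival_pos r).le
    (mul_nonneg (sub_nonneg.2 r.mix_le_one) (zero_le_one.trans one_le_evidence))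

lemma probReject_le {ε : ℝ} (h : (1 - r.mix) * g.evidence r ≤ ε * r.mix) :
    g.probReject r ≤ ε * g.probAccept r := by
  rw [probReject, probAccept, mul_left_comm ε]
  exact mul_le_mul_of_nonneg_left h (g.survival_pos r).le

lemma le_probReject {ε x : ℝ} (hε : 0 ≤ ε) (hx : x ∈ g.discrepancies)
    (h : (1 - ε) * r.mix ≤ ε * ((1 - r.mix) * Real.cosh (r.lam * x))) :
    (1 - ε) * g.probAccept r ≤ ε * g.probReject r := by
  rw [probAccept, probReject, mul_left_comm, mul_left_comm ε]
  have hmix : 0 ≤ 1 - r.mix := sub_nonneg.2 r.mix_le_one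
  exact mul_le_mul_of_nonneg_left (h.trans (by gcongr; exact cosh_le_evidence hx))
    (g.survival_pos r).le

lemma mean_of_verdict {f : Mode → ℝ} (ha : f .accepting = 1) (hr : ∀ s, f (.rejecting s) = 0) :
    g.mean r f = g.probAccept r + (1 - g.probAccept r - g.probReject r) * f .void := by
  simp only [mean, ha, hr, ← Finset.sum_mul, sum_exp_signedSum, probAccept, probReject, evidence,
    discrepancies, List.map_cons, List.prod_cons]
  ring

lemma survival_mul_evidence_le_one (h : (g.discrepancies.map fun x => |x|).sum ≤ g.variation) :
    g.survival r * g.evidence r ≤ 1 := by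
  have hsum : (g.discrepancies.map fun x => |r.lam * x|).sum =
      r.lam * (g.discrepancies.map fun x => |x|).sum := by
    simp only [abs_mul, abs_of_nonneg r.lam_nonneg, List.sum_map_mul_left]
  calc g.survival r * g.evidence r
      ≤ g.survival r * Real.exp (g.discrepancies.map fun x => |r.lam * x|).sum := by
        gcongr
        · exact (g.survival_pos r).le
        · simpa [evidence, Function.comp_def] using
            prod_cosh_le_exp_sum_abs (g.discrepancies.map (r.lam * ·))
    _ ≤ g.survival r * Real.exp (r.lam * g.variation) := by
        rw [hsum]
        gcongr
        exacts [(g.survival_pos r).le, r.lam_nonneg]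
    _ = 1 := by rw [survival, ← Real.exp_add, neg_add_cancel, Real.exp_zero]

lemma probAccept_add_probReject_le_one
    (h : (g.discrepancies.map fun x => |x|).sum ≤ g.variation) :
    g.probAccept r + g.probReject r ≤ 1 := by
  have hev := survival_mul_evidence_le_one (r := r) h
  have hsurv : g.survival r ≤ 1 :=
    (le_mul_of_one_le_right (g.survival_pos r).le one_le_evidence).trans hev
  calc g.probAccept r + g.probReject r
      = r.mix * g.survival r + (1 - r.mix) * (g.survival r * g.evidence r) := by
        rw [probAccept, probReject]; ring
    _ ≤ r.mix * 1 + (1 - r.mix) * 1 := by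
        gcongr
        exacts [r.mix_pos.le, sub_nonneg.2 r.mix_le_one]
    _ = 1 := by ring

end Ledger

namespace Protocol

variable {α : Type*} {Q M : Type} (A : Protocol α Q M) (w : List α)

/-- The ledger at the beginning of a round, once the head has left the left end-marker. -/
def initial : Ledger Q := ⟨A.start, 1, 0, 0, []⟩

/-- `A.Path w l g`: on input `w`, a round may begin with the messages `l`, which lead to the
ledger `g`. -/
inductive Path : List M → Ledger Q → Prop
  | nil : Path [] A.initial
  | snoc {l : List M} {g : Ledger Q} {m : M} {q mv close e} :
      Path l g → A.action g.q m (tape w g.i) = .go q mv close e →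
      Path (l ++ [m]) (g.next q mv close e)

/-- `A.Transcript w l g`: on input `w`, the messages `l` lead to the ledger `g` and end the round
there. -/
def Transcript (l : List M) (g : Ledger Q) : Prop :=
  ∃ l' m, l = l' ++ [m] ∧ A.Path w l' g ∧ A.action g.q m (tape w g.i) = .finish

variable {A w}

lemma Path.sum_abs_discrepancies_le {l : List M} {g : Ledger Q} (h : A.Path w l g) :
    (g.discrepancies.map fun x => |x|).sum ≤ g.variation := by
  induction h with
  | nil => simp [initial, Ledger.discrepancies]
  | @snoc _ g _ _ _ close e _ _ ih =>
    have hadd := absSum_add_le g.d e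
    simp only [absSum, Ledger.discrepancies, List.map_cons, List.sum_cons] at ih hadd
    cases close <;>
      simp only [Ledger.discrepancies, Ledger.next, rotate, absSum, if_true, Bool.false_eq_true,
        if_false, List.map_cons, List.sum_cons, abs_zero] <;>
      linarith

end Protocol

namespace Protocol

variable {α : Type*} {Q M : Type} [Finite Q] [Finite M] [Inhabited M] (A : Protocol α Q M)
  (r : Rates) (P : (A.verifier r).Prover) (w : List α)

/-- The configuration with a given state and head position in which `n` symbols have been sent. -/
def config (s : State (Reading Q M) (Q × Mode)) (i n : ℕ) : (A.verifier r).Config :=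
  ⟨s, i, List.replicate n (default : M)⟩

/-- The probability of acceptance within `t` steps when the verifier, having sent `n` symbols, is
about to ask for the next letter of the message in phase `q` and mode `η`. -/
noncomputable def accAsk (t : ℕ) (q : Q) (i n : ℕ) (η : Mode) : ℝ :=
  (A.verifier r).accFrom P w t (PMF.pure (A.config r (.comm (q, η)) i n))

/-- The probability of acceptance within `t` steps when the verifier, having sent `n` symbols, is
returning to the left end-marker. -/
noncomputable def accBack (t i n : ℕ) : ℝ :=
  (A.verifier r).accFrom P w t (PMF.pure (A.config r (.read none) i n))

variable {A r} in
/-- The reply of the prover when `n` symbols have been sent before. -/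
def reply (n : ℕ) : M := P w (List.replicate (n + 1) (default : M))

/-- The probability of acceptance within `t` steps when the verifier, having sent `n` symbols, is
about to ask for the next letter of the message, and the law of its mode is the one implied by the
ledger `g`. -/
noncomputable def value (t : ℕ) (g : Ledger Q) (n : ℕ) : ℝ :=
  g.mean r (A.accAsk r P w t g.q g.i n)

variable {A r P w}

lemma step_config_none (i n : ℕ) :
    (A.verifier r).step P w (A.config r (.read none) i n) =
      (A.delta r none (tape w i)).map fun x => A.config r x.1 (x.2.apply i) n :=
  rfl

lemma step_config_some (q : Q) (η : Mode) (m : M) (i n : ℕ) :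
    (A.verifier r).step P w (A.config r (.read (some (q, η, m))) i n) =
      (react r η (A.action q m (tape w i))).map fun x => A.config r x.1 (x.2.apply i) n :=
  rfl

lemma step_config_comm (q : Q) (η : Mode) (i n : ℕ) :
    (A.verifier r).step P w (A.config r (.comm (q, η)) i n) =
      PMF.pure (A.config r (.read (some (q, η, reply P w n))) i (n + 1)) :=
  congrArg (fun h : List M =>
    PMF.pure (⟨.read (some (q, η, P w h)), i, h⟩ : (A.verifier r).Config)) List.replicate_succ'.symm

lemma accBack_nonneg (t i n : ℕ) : 0 ≤ A.accBack r P w t i n :=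
  Verifier.accFrom_nonneg ..

lemma accBack_zero (i n : ℕ) : A.accBack r P w 0 i n = 0 :=
  Verifier.accFrom_zero _ _ _ nofun

lemma accBack_succ_zero (t n : ℕ) : A.accBack r P w (t + 1) 0 n = A.value r P w t A.initial n := by
  have hstart : A.accBack r P w (t + 1) 0 n = (A.verifier r).accFrom P w t
      (r.sample.map fun η => A.config r (.comm (A.start, η)) 1 n) := by
    rw [accBack, Verifier.accFrom_succ, step_config_none]
    exact congrArg _ (PMF.map_comp ..)
  rw [hstart, r.accFrom_sample]
  simp [value, Ledger.mean, Ledger.survival, initial, signedSum, accAsk, Finset.sum_sub_distrib]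
  ring

lemma accBack_succ_succ (t i n : ℕ) :
    A.accBack r P w (t + 1) (i + 1) n = A.accBack r P w t i n := by
  have hdelta : A.delta r none (tape w (i + 1)) = PMF.pure (.read none, .left) := by
    rcases hσ : tape w (i + 1) with _ | _ | _
    · simp [tape_eq_leftEnd] at hσ
    all_goals rfl
  rw [accBack, Verifier.accFrom_succ, step_config_none, hdelta, PMF.pure_map]
  rfl

lemma accBack_add (t i n : ℕ) : A.accBack r P w (t + i) i n = A.accBack r P w t 0 n := by
  induction i with
  | zero => rfl
  | succ i ih => rw [← add_assoc, accBack_succ_succ, ih]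

lemma accAsk_of_lt_two {t : ℕ} (ht : t < 2) (q : Q) (i n : ℕ) :
    A.accAsk r P w t q i n = fun _ => 0 := by
  funext η
  interval_cases t
  · exact Verifier.accFrom_zero _ _ _ nofun
  · rw [accAsk, Verifier.accFrom_succ, step_config_comm]
    exact Verifier.accFrom_zero _ _ _ nofun

lemma accAsk_add_two (t : ℕ) (q : Q) (i n : ℕ) (η : Mode) :
    A.accAsk r P w (t + 2) q i n η = (A.verifier r).accFrom P w t
      ((react r η (A.action q (reply P w n) (tape w i))).map fun x =>
        A.config r x.1 (x.2.apply i) (n + 1)) := by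
  rw [accAsk, Verifier.accFrom_succ, step_config_comm, Verifier.accFrom_succ, step_config_some]

lemma value_of_lt_two {t : ℕ} (ht : t < 2) (g : Ledger Q) (n : ℕ) : A.value r P w t g n = 0 := by
  rw [value, accAsk_of_lt_two ht, Ledger.mean_zero]

lemma value_trap {g : Ledger Q} {n : ℕ}
    (h : A.action g.q (reply P w n) (tape w g.i) = .trap) (t : ℕ) :
    A.value r P w (t + 2) g n = 0 := by
  have hask : A.accAsk r P w (t + 2) g.q g.i n = fun _ => 0 := by
    funext η
    rw [accAsk_add_two, h, react, PMF.pure_map]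
    exact Verifier.accFrom_reject ..
  rw [value, hask, Ledger.mean_zero]

lemma value_finish {g : Ledger Q} {n : ℕ}
    (h : A.action g.q (reply P w n) (tape w g.i) = .finish) (t : ℕ) :
    A.value r P w (t + 2) g n = g.probAccept r +
      (1 - g.probAccept r - g.probReject r) * A.accBack r P w t g.i (n + 1) := by
  have hask (η : Mode) : A.accAsk r P w (t + 2) g.q g.i n η = (A.verifier r).accFrom P w t
      (PMF.pure (A.config r (verdict η) g.i (n + 1))) := by
    rw [accAsk_add_two, h, react, PMF.pure_map]
    rfl
  rw [value, Ledger.mean_of_verdict, hask]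
  · rfl
  · rw [hask]
    exact Verifier.accFrom_accept ..
  · intro s
    rw [hask]
    exact Verifier.accFrom_reject ..

lemma value_go {g : Ledger Q} {n : ℕ} {q mv close e}
    (h : A.action g.q (reply P w n) (tape w g.i) = .go q mv close e) (t : ℕ) :
    A.value r P w (t + 2) g n = A.value r P w t (g.next q mv close e) (n + 1) := by
  have hask : A.accAsk r P w (t + 2) g.q g.i n =
      r.average close e (A.accAsk r P w t q (mv.apply g.i) (n + 1)) := by
    funext η
    rw [accAsk_add_two, h, react, PMF.map_comp]
    exact r.accFrom_hop ..
  rw [value, hask, Ledger.mean_average]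
  rfl

lemma Path.value_eq {l : List M} {g : Ledger Q} (h : A.Path w l g) {n : ℕ}
    (hl : ∀ k (hk : k < l.length), reply P w (n + k) = l[k]) (t : ℕ) :
    A.value r P w (t + 2 * l.length) A.initial n = A.value r P w t g (n + l.length) := by
  induction h generalizing t with
  | nil => rfl
  | @snoc l g m q mv close e _ hgo ih =>
    have hm : reply P w (n + l.length) = m := by simpa using hl l.length (by simp)
    have hinit (k) (hk : k < l.length) : reply P w (n + k) = l[k] := by
      rw [hl k (by simp; omega), List.getElem_append_left hk]
    rw [List.length_append, List.length_singleton, mul_add, mul_one, ← add_assoc, add_right_comm,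
      ih hinit, value_go (hm ▸ hgo), add_assoc]

/-- One round adds at most what is needed to keep the probability of acceptance below `ε`, because
every round that can end favours rejection by the odds `1 - ε` to `ε`. -/
theorem acceptProb_verifier_le {ε : ℝ} (hε : 0 ≤ ε)
    (h : ∀ l g, A.Transcript w l g → (1 - ε) * g.probAccept r ≤ ε * g.probReject r) :
    (A.verifier r).acceptProb P w ≤ ENNReal.ofReal ε := by
  have key (t : ℕ) : (∀ i n, A.accBack r P w t i n ≤ ε) ∧
      ∀ l g n, A.Path w l g → A.value r P w t g n ≤ ε := by
    induction t using Nat.strong_induction_on with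
    | _ t ih =>
    constructor
    · intro i n
      rcases t with _ | t
      · exact (accBack_zero i n).trans_le hε
      · rcases i with _ | i
        · rw [accBack_succ_zero]
          exact (ih t t.lt_succ_self).2 _ _ _ .nil
        · rw [accBack_succ_succ]
          exact (ih t t.lt_succ_self).1 _ _
    · intro l g n hl
      rcases lt_or_ge t 2 with ht | ht
      · exact (value_of_lt_two ht g n).trans_le hε
      · obtain ⟨t, rfl⟩ := Nat.exists_eq_add_of_le' ht
        rcases hA : A.action g.q (reply P w n) (tape w g.i) with _ | _ | ⟨q, mv, close, e⟩
        · exact (value_trap hA t).trans_le hε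
        · have hodds := h _ g ⟨l, _, rfl, hl, hA⟩
          have hle := Ledger.probAccept_add_probReject_le_one (r := r) hl.sum_abs_discrepancies_le
          calc A.value r P w (t + 2) g n
              = g.probAccept r + (1 - g.probAccept r - g.probReject r) *
                  A.accBack r P w t g.i (n + 1) := value_finish hA t
            _ ≤ g.probAccept r + (1 - g.probAccept r - g.probReject r) * ε := by
              gcongr
              · linarith
              · exact (ih t (by omega)).1 _ _
            _ ≤ ε := by linarith
        · rw [value_go hA]
          exact (ih t (by omega)).2 _ _ _ (hl.snoc hA)
  exact Verifier.acceptProb_le_ofReal _ _ _ fun t => (key t).1 0 0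

end Protocol

lemma le_of_geometric_recursion {a b : ℝ} (ha : 0 < a) (hb : 0 ≤ b) (hab : a + b ≤ 1)
    {f : ℕ → ℕ → ℝ} (hf : ∀ t k, 0 ≤ f t k) {T : ℕ}
    (hrec : ∀ t k, f (t + T) k = a + (1 - a - b) * f t (k + 1)) (n k : ℕ) :
    a / (a + b) * (1 - (1 - a - b) ^ n) ≤ f (n * T) k := by
  induction n generalizing k with
  | zero => simpa using hf 0 k
  | succ n ih =>
    have hdiv : a / (a + b) * (a + b) = a := div_mul_cancel₀ _ (by positivity)
    calc a / (a + b) * (1 - (1 - a - b) ^ (n + 1))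
        = a / (a + b) * (a + b) +
            (1 - a - b) * (a / (a + b) * (1 - (1 - a - b) ^ n)) := by ring
      _ ≤ a + (1 - a - b) * f (n * T) (k + 1) := by
        rw [hdiv]
        gcongr
        · linarith
        · exact ih (k + 1)
      _ = f ((n + 1) * T) k := by rw [Nat.succ_mul, hrec]

lemma exists_le_of_geometric_recursion {a b ε : ℝ} (ha : 0 < a) (hb : 0 ≤ b) (hab : a + b ≤ 1)
    (hε : b ≤ ε * a) {f : ℕ → ℕ → ℝ} (hf : ∀ t k, 0 ≤ f t k) {T : ℕ}
    (hrec : ∀ t k, f (t + T) k = a + (1 - a - b) * f t (k + 1)) {c : ℝ} (hc : c < 1 - ε) (k : ℕ) :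
    ∃ t, c ≤ f t k := by
  have hpow := tendsto_pow_atTop_nhds_zero_of_lt_one (r := 1 - a - b) (by linarith) (by linarith)
  have hlim := (hpow.const_sub 1).const_mul (a / (a + b))
  have hlt : c < a / (a + b) * (1 - 0) := by
    refine hc.trans_le ?_
    rw [sub_zero, mul_one, le_div_iff₀ (by positivity)]
    nlinarith
  obtain ⟨n, hn⟩ := (hlim.eventually_const_lt hlt).exists
  exact ⟨n * T, hn.le.trans (le_of_geometric_recursion ha hb hab hf hrec n k)⟩

namespace Protocol

variable {α : Type*} {Q M : Type} [Finite Q] [Finite M] [Inhabited M] {A : Protocol α Q M}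
  {r : Rates} {w : List α}

/-- The prover that sends the word `W w` again and again on input `w`. -/
def cyclicProver (A : Protocol α Q M) (r : Rates) (W : List α → List M) : (A.verifier r).Prover :=
  fun w (h : List M) => (W w).getD ((h.length - 1) % (W w).length) default

lemma reply_cyclicProver (W : List α → List M) (k : ℕ) {j : ℕ} (hj : j < (W w).length) :
    reply (A.cyclicProver r W) w (k * (W w).length + j) = (W w)[j] := by
  have hmod : ((List.replicate (k * (W w).length + j + 1) (default : M)).length - 1) %
      (W w).length = j := by
    rw [List.length_replicate, Nat.add_sub_cancel, mul_comm, Nat.mul_add_mod, Nat.mod_eq_of_lt hj]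
  exact (congrArg ((W w).getD · default) hmod).trans (List.getD_eq_getElem ..)

lemma accBack_cyclicProver {W : List α → List M} {g : Ledger Q} (h : A.Transcript w (W w) g) :
    ∃ T, ∀ t k, A.accBack r (A.cyclicProver r W) w (t + T) 0 (k * (W w).length) =
      g.probAccept r + (1 - g.probAccept r - g.probReject r) *
        A.accBack r (A.cyclicProver r W) w t 0 ((k + 1) * (W w).length) := by
  obtain ⟨l, m, hW, hl, hfin⟩ := h
  have hlen : (W w).length = l.length + 1 := by simp [hW]
  refine ⟨g.i + 2 + 2 * l.length + 1, fun t k => ?_⟩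
  have hpath (j) (hj : j < l.length) :
      reply (A.cyclicProver r W) w (k * (W w).length + j) = l[j] := by
    rw [reply_cyclicProver W k (by omega)]
    simp only [hW, List.getElem_append_left hj]
  have hlast : reply (A.cyclicProver r W) w (k * (W w).length + l.length) = m := by
    rw [reply_cyclicProver W k (by omega)]
    simp only [hW, List.getElem_concat_length]
  rw [← add_assoc, accBack_succ_zero, ← add_assoc, ← add_assoc, hl.value_eq hpath,
    value_finish (hlast ▸ hfin), accBack_add, add_assoc, ← hlen, Nat.succ_mul]

theorem le_acceptProb_cyclicProver {W : List α → List M} {g : Ledger Q} {ε : ℝ}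
    (h : A.Transcript w (W w) g) (hε : g.probReject r ≤ ε * g.probAccept r) :
    ENNReal.ofReal (1 - ε) ≤ (A.verifier r).acceptProb (A.cyclicProver r W) w := by
  obtain ⟨T, hT⟩ := accBack_cyclicProver (r := r) h
  obtain ⟨l, m, -, hl, -⟩ := h
  refine Verifier.ofReal_le_acceptProb _ _ _ fun c hc => ?_
  obtain ⟨t, ht⟩ := exists_le_of_geometric_recursion g.probAccept_pos g.probReject_nonneg
    (Ledger.probAccept_add_probReject_le_one hl.sum_abs_discrepancies_le) hε
    (fun t k => accBack_nonneg t 0 (k * (W w).length)) hT hc 0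
  rw [Nat.zero_mul] at ht
  exact ⟨t, ht⟩

theorem exists_isWeakIPS {L : Language α} {ε : ℝ} (hε : 0 ≤ ε)
    (hmem : ∀ w ∈ L, ∃ l g, A.Transcript w l g ∧ g.probReject r ≤ ε * g.probAccept r)
    (hnot : ∀ w ∉ L, ∀ l g, A.Transcript w l g →
      (1 - ε) * g.probAccept r ≤ ε * g.probReject r) :
    ∃ P, (A.verifier r).IsWeakIPS P L ε := by
  choose! W hW using hmem
  refine ⟨A.cyclicProver r W, fun w hw => ?_, fun w hw P => acceptProb_verifier_le hε (hnot w hw)⟩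
  obtain ⟨g, hg, hodds⟩ := hW w hw
  exact le_acceptProb_cyclicProver hg hodds

end Protocol

lemma cosh_mul_log_le {E x : ℝ} (hE : 1 ≤ E) (hx : |x| ≤ 1) : Real.cosh (x * Real.log E) ≤ E := by
  have hlog := Real.log_nonneg hE
  calc Real.cosh (x * Real.log E) ≤ Real.exp |x * Real.log E| := cosh_le_exp_abs _
    _ ≤ Real.exp (Real.log E) := by
      rw [abs_mul, abs_of_nonneg hlog]
      gcongr
      exact mul_le_of_le_one_left hlog hx
    _ = E := Real.exp_log (by positivity)

lemma pow_le_two_mul_cosh_mul_log {E x : ℝ} {n : ℕ} (hE : 1 ≤ E) (hx : n ≤ |x|) :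
    E ^ n ≤ 2 * Real.cosh (x * Real.log E) := by
  have hlog := Real.log_nonneg hE
  calc E ^ n = Real.exp (n * Real.log E) := by
        rw [Real.exp_nat_mul, Real.exp_log (by positivity)]
    _ ≤ Real.exp |x * Real.log E| := by
      rw [abs_mul, abs_of_nonneg hlog]
      gcongr
    _ ≤ 2 * Real.cosh (x * Real.log E) := exp_abs_le_two_mul_cosh _

lemma exists_rates {ε : ℝ} (hε : 0 < ε) : ∃ r : Rates,
    (∀ x, |x| ≤ 1 / 4 → (1 - r.mix) * Real.cosh (r.lam * x) ≤ ε * r.mix) ∧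
    ∀ x, 3 / 4 ≤ |x| → (1 - ε) * r.mix ≤ ε * ((1 - r.mix) * Real.cosh (r.lam * x)) := by
  obtain ⟨E, hE, hεE⟩ : ∃ E : ℝ, 1 ≤ E ∧ 2 ≤ ε * E :=
    ⟨1 + 2 / ε, le_add_of_nonneg_right (by positivity), by field_simp; linarith⟩
  obtain ⟨μ, hμ⟩ : ∃ μ, μ = (1 + ε / E)⁻¹ := ⟨_, rfl⟩
  have hμ₀ : 0 < μ := by rw [hμ]; positivity
  have hμ₁ : 1 - μ = μ * (ε / E) := by rw [hμ]; field_simp; ring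
  have habs (x : ℝ) : |4 * x| = 4 * |x| := by rw [abs_mul, abs_of_nonneg zero_le_four]
  have hcomm (x : ℝ) : 4 * Real.log E * x = 4 * x * Real.log E := by ring
  refine ⟨⟨4 * Real.log E, μ, mul_nonneg zero_le_four (Real.log_nonneg hE), hμ₀,
    sub_nonneg.1 (by rw [hμ₁]; positivity)⟩, fun x hx => ?_, fun x hx => ?_⟩
  · have hcosh : Real.cosh (4 * x * Real.log E) ≤ E :=
      cosh_mul_log_le hE (by rw [habs]; linarith)
    calc (1 - μ) * Real.cosh (4 * Real.log E * x) ≤ μ * (ε / E) * E := by rw [hμ₁, hcomm]; gcongr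
      _ = ε * μ := by field_simp
  · have hcosh : E ^ 3 ≤ 2 * Real.cosh (4 * x * Real.log E) :=
      pow_le_two_mul_cosh_mul_log hE (by rw [habs]; push_cast; linarith)
    calc (1 - ε) * μ ≤ (ε * E) ^ 2 / 2 * μ := by gcongr; nlinarith
      _ = ε * (μ * (ε / E) * (E ^ 3 / 2)) := by field_simp
      _ ≤ ε * ((1 - μ) * Real.cosh (4 * Real.log E * x)) := by
        rw [hμ₁, hcomm]
        gcongr
        linarith

lemma ofDigits_eq_div {b : ℕ} (a : ℕ → Fin b) :
    Real.ofDigits a = ((a 0 : ℕ) + Real.ofDigits fun i => a (i + 1)) / b := by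
  rw [Real.ofDigits_eq_sum_add_ofDigits a 1]
  simp [Real.ofDigitsTerm]
  ring

lemma exists_ofDigits_mul_pow_succ {b : ℕ} (a : ℕ → Fin b) (k : ℕ) :
    ∃ N : ℕ, Real.ofDigits a * b ^ (k + 1) =
      b * N + (a k : ℕ) + Real.ofDigits fun i => a (i + (k + 1)) := by
  have hb : (b : ℝ) ≠ 0 := Nat.cast_ne_zero.2 (a 0).pos.ne'
  induction k generalizing a with
  | zero => exact ⟨0, by rw [ofDigits_eq_div a]; field_simp; simp; ring⟩
  | succ k ih =>
    obtain ⟨N, hN⟩ := ih fun i => a (i + 1)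
    refine ⟨a 0 * b ^ k + N, ?_⟩
    calc Real.ofDigits a * b ^ (k + 1 + 1)
        = (a 0 : ℕ) * b ^ (k + 1) + (Real.ofDigits fun i => a (i + 1)) * b ^ (k + 1) := by
          rw [ofDigits_eq_div a]; field_simp; ring
      _ = _ := by rw [hN]; push_cast; ring_nf

lemma one_le_abs_natCast_sub {u v : ℕ} (h : u ≠ v) : (1 : ℝ) ≤ |(u : ℝ) - v| := by
  have : (1 : ℤ) ≤ |(u : ℤ) - v| := Int.one_le_abs (by omega)
  exact_mod_cast this

lemma exists_encoding (S : Set ℕ) : ∃ p : ℝ,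
    (∀ k ∈ S, ∃ m : ℕ, |2 * m + 1 - p * 8 ^ (k + 1)| ≤ 1 / 4) ∧
    ∀ k ∉ S, ∀ m : ℕ, 3 / 4 ≤ |2 * m + 1 - p * 8 ^ (k + 1)| := by
  classical
  let a (k : ℕ) : Fin 8 := if k ∈ S then 1 else 0
  have ha (k : ℕ) : ((a k : ℕ) : ℝ) ≤ 1 := by by_cases hk : k ∈ S <;> simp [a, hk]
  have key (k : ℕ) : ∃ (N : ℕ) (τ : ℝ), 0 ≤ τ ∧ τ ≤ 1 / 4 ∧
      Real.ofDigits a * 8 ^ (k + 1) = 8 * N + (a k : ℕ) + τ := by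
    obtain ⟨N, hN⟩ := exists_ofDigits_mul_pow_succ a k
    refine ⟨N, _, Real.ofDigits_nonneg _, ?_, by simpa using hN⟩
    rw [ofDigits_eq_div]
    have h₁ := ha (0 + (k + 1))
    have h₂ := Real.ofDigits_le_one fun i => a (i + 1 + (k + 1))
    push_cast
    linarith
  refine ⟨Real.ofDigits a, fun k hk => ?_, fun k hk m => ?_⟩ <;>
    obtain ⟨N, τ, hτ₀, hτ₁, h⟩ := key k <;> rw [h]
  · refine ⟨4 * N, ?_⟩
    simp only [a, if_pos hk]
    push_cast
    rw [abs_le]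
    constructor <;> norm_num <;> linarith
  · have hodd : (1 : ℝ) ≤ |((2 * m + 1 : ℕ) : ℝ) - (8 * N : ℕ)| :=
      one_le_abs_natCast_sub (by omega)
    have hτ : |τ| ≤ 1 / 4 := by rwa [abs_of_nonneg hτ₀]
    have hsub := abs_sub_abs_le_abs_sub (((2 * m + 1 : ℕ) : ℝ) - (8 * N : ℕ)) τ
    push_cast at hodd hsub
    simp only [a, if_neg hk, Fin.val_zero, Nat.cast_zero, add_zero, ← sub_sub]
    linarith

namespace Protocol

variable {α : Type*} {Q M : Type} (A : Protocol α Q M) (w : List α)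

/-- Some messages of an honest prover lead from the beginning of a round to phase `q`, position `i`
and discrepancies `d`, with all the tests completed meanwhile having been passed. -/
def Attains (q : Q) (i : ℕ) (d : ℝ × ℝ × ℝ) : Prop :=
  ∃ l g, A.Path w l g ∧ g.q = q ∧ g.i = i ∧ g.d = d ∧ ∀ x ∈ g.closed, x = 0

variable {A w}

lemma attains_start : A.Attains w A.start 1 (0, 0, 0) :=
  ⟨[], _, .nil, rfl, rfl, rfl, by simp [initial]⟩

lemma Attains.go {q i d m q' mv close e} (h : A.Attains w q i d)
    (hA : A.action q m (tape w i) = .go q' mv close e) (hd : close = true → (d + e).1 = 0) :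
    A.Attains w q' (mv.apply i) (if close then rotate 0 (d + e) else d + e) := by
  obtain ⟨l, g, hl, rfl, rfl, rfl, hg⟩ := h
  refine ⟨_, _, hl.snoc hA, rfl, rfl, rfl, ?_⟩
  cases close
  · exact hg
  · exact List.forall_mem_cons.2 ⟨hd rfl, hg⟩

lemma Attains.iterate {q i d m e} (h : A.Attains w q i d)
    (hA : A.action q m (tape w i) = .go q .stay false e) (u : ℕ) :
    A.Attains w q i (d + u • e) := by
  induction u with
  | zero => simpa using h
  | succ u ih =>
    rw [succ_nsmul, ← add_assoc]
    exact ih.go hA nofun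

lemma Attains.block {q i m m' q' mv e₂ e₃ f₂ f₃ d₃} {u i' : ℕ} {d₂' d₃' : ℝ}
    (h : A.Attains w q i (-u, 0, d₃))
    (hA : A.action q m (tape w i) = .go q .stay false (1, e₂, e₃))
    (hB : A.action q m' (tape w i) = .go q' mv true (0, f₂, f₃)) (hi : mv.apply i = i')
    (hd₂ : u * e₂ + f₂ = d₂') (hd₃ : d₃ + u * e₃ + f₃ = d₃') :
    A.Attains w q' i' (d₂', 0, d₃') := by
  simpa [rotate, hi, hd₂, hd₃] using (h.iterate hA u).go hB (by simp)

end Protocol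

section

variable {α : Type*} (code : α → ℕ)

/-- An encoding of the words by natural numbers: since it is evaluated by a sequence of affine
maps, a verifier can follow it while reading the word. -/
def numeral (w : List α) : ℕ := w.foldl (fun k a => 2 ^ code a * (2 * k + 1)) 0

variable {code}

lemma numeral_append_singleton (w : List α) (a : α) :
    numeral code (w ++ [a]) = 2 ^ code a * (2 * numeral code w + 1) := by
  simp [numeral]

lemma two_pow_mul_odd_inj {m n k l : ℕ} (h : 2 ^ m * (2 * k + 1) = 2 ^ n * (2 * l + 1)) :
    m = n ∧ k = l := by
  have hval (m k : ℕ) : padicValNat 2 (2 ^ m * (2 * k + 1)) = m := by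
    rw [padicValNat.mul (by positivity) (by positivity), padicValNat.prime_pow,
      padicValNat.eq_zero_of_not_dvd (by omega), add_zero]
  obtain rfl : m = n := by rw [← hval m k, h, hval]
  exact ⟨rfl, by have := Nat.eq_of_mul_eq_mul_left (by positivity) h; omega⟩

lemma numeral_injective (hcode : Function.Injective code) :
    Function.Injective (numeral code) := by
  intro v
  induction v using List.reverseRecOn with
  | nil =>
    intro w h
    rcases w.eq_nil_or_concat with rfl | ⟨w, b, rfl⟩
    · rfl
    · simp [numeral] at h
  | append_singleton v a ih =>
    intro w h
    rcases w.eq_nil_or_concat with rfl | ⟨w, b, rfl⟩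
    · simp [numeral] at h
    · rw [List.concat_eq_append, numeral_append_singleton, numeral_append_singleton] at h
      obtain ⟨hab, hvw⟩ := two_pow_mul_odd_inj h
      rw [hcode hab, ih hvw, List.concat_eq_append]

end

/-- The phases of a round: checking the numerals of the prefixes of the input, checking the powers
of `8`, checking the last of these powers, and comparing its multiple by `p` with an odd number. -/
inductive Phase where
  | scan
  | pow
  | last
  | fin
  deriving DecidableEq

instance : Fintype Phase where
  elems := {.scan, .pow, .last, .fin}
  complete := by rintro (_ | _ | _ | _) <;> decide

/-- The communication alphabet: the ticks are counted, and the other letters end a block. -/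
inductive Msg where
  | tick
  | sep
  | jump
  deriving DecidableEq, Inhabited

instance : Fintype Msg where
  elems := {.tick, .sep, .jump}
  complete := by rintro (_ | _ | _) <;> decide

section

variable {α : Type*} (code : α → ℕ) (p : ℝ)

/-- The reaction to a message. The first running test checks the length of the current block, the
second one predicts the length of the next block, and the third one checks that the number of
blocks in the phase `pow` is the numeral of the input. -/
noncomputable def reaction : Phase → Msg → TapeSymbol α → Action Phase
  | .scan, .tick, .letter a => .go .scan .stay false (1, -2 ^ (code a + 1), 0)
  | .scan, .sep, .letter a => .go .scan .right true (0, -2 ^ code a, 0)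
  | .scan, .tick, .rightEnd => .go .scan .stay false (1, 0, 1)
  | .scan, .sep, .rightEnd => .go .pow .stay true (0, -1, 0)
  | .pow, .tick, _ => .go .pow .stay false (1, -8, 0)
  | .pow, .sep, _ => .go .pow .stay true (0, 0, -1)
  | .pow, .jump, _ => .go .last .stay true (0, 0, 0)
  | .last, .tick, _ => .go .last .stay false (1, -p, 0)
  | .last, .sep, _ => .go .fin .stay true (0, 1, 0)
  | .fin, .tick, _ => .go .fin .stay false (2, 0, 0)
  | .fin, .sep, .rightEnd => .finish
  | _, _, _ => .trap

/-- The protocol in which the honest prover sends the numerals of the prefixes of the input `w` and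
the powers of `8` up to `8 ^ (numeral code w + 1)`, all in unary, followed by a number `m` for which
`2 * m + 1` is close to `p * 8 ^ (numeral code w + 1)`. -/
noncomputable def protocol : Protocol α Phase Msg where
  start := .scan
  action := reaction code p
  eq_rightEnd_of_finish {q m σ} h := by cases q <;> cases m <;> cases σ <;> simp_all [reaction]
  move_of_go {q m σ _ _ _ _} h := by
    cases q <;> cases m <;> cases σ <;> simp only [reaction, reduceCtorEq, Action.go.injEq] at h <;>
      obtain ⟨-, rfl, -⟩ := h <;> simp

variable {code p} {w : List α}

lemma numeral_take_add_one {j : ℕ} (hj : j < w.length) :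
    numeral code (w.take (j + 1)) = 2 ^ code w[j] * (2 * numeral code (w.take j) + 1) := by
  rw [List.take_add_one, List.getElem?_eq_getElem hj, Option.toList_some, numeral_append_singleton]

lemma attains_scan {j : ℕ} (hj : j ≤ w.length) :
    (protocol code p).Attains w .scan (j + 1) (-numeral code (w.take j), 0, 0) := by
  induction j with
  | zero =>
    simp only [List.take_zero, numeral, List.foldl_nil, Nat.cast_zero, neg_zero]
    exact Protocol.attains_start
  | succ j ih =>
    have htape := tape_succ_of_lt (w := w) hj
    rw [numeral_take_add_one hj]
    refine (ih (by omega)).block (m := .tick) (m' := .sep) (by rw [htape]; rfl)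
      (by rw [htape]; rfl) rfl ?_ (by ring)
    push_cast
    ring

lemma attains_pow (j : ℕ) : (protocol code p).Attains w .pow (w.length + 1)
    (-(8 ^ j : ℕ), 0, numeral code w - j) := by
  induction j with
  | zero =>
    have htape := tape_length_add_one w
    have hscan := attains_scan (code := code) (p := p) (w := w) le_rfl
    rw [List.take_length] at hscan
    exact hscan.block (m := .tick) (m' := .sep) (by rw [htape]; rfl) (by rw [htape]; rfl) rfl
      (by simp) (by simp)
  | succ j ih =>
    exact ih.block (m := .tick) (m' := .sep) rfl rfl rfl (by push_cast; ring) (by push_cast; ring)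

lemma attains_fin (m : ℕ) : (protocol code p).Attains w .fin (w.length + 1)
    (2 * m + 1 - p * 8 ^ (numeral code w + 1), 0, 0) := by
  have hlast : (protocol code p).Attains w .last (w.length + 1)
      (-(8 ^ (numeral code w + 1) : ℕ), 0, 0) :=
    (attains_pow (numeral code w)).block (m := .tick) (m' := .jump) rfl rfl rfl
      (by push_cast; ring) (by simp)
  have hfin : (protocol code p).Attains w .fin (w.length + 1)
      (1 - p * 8 ^ (numeral code w + 1), 0, 0) :=
    hlast.block (m := .tick) (m' := .sep) rfl rfl rfl (by push_cast; ring) (by simp)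
  convert hfin.iterate (m := .tick) rfl m using 1
  simp
  ring

end

section

variable {α : Type*} (code : α → ℕ) (p : ℝ)

/-- The discrepancies `d` that occur in phase `q` at position `i` if the completed tests were
passed: `u` is the number of ticks in the current block and `j` the number of blocks completed in
the phases `scan` and `pow`, respectively. -/
inductive Consistent (w : List α) : Phase → ℕ → ℝ × ℝ × ℝ → Prop
  | scan {d : ℝ × ℝ × ℝ} (j u : ℕ) (hj : j < w.length)
      (hd : d = ((u - numeral code (w.take j) : ℝ), -(2 ^ (code w[j] + 1) * u : ℝ), 0)) :
      Consistent w .scan (j + 1) d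
  | edge {d : ℝ × ℝ × ℝ} (u : ℕ) (hd : d = ((u - numeral code w : ℝ), 0, (u : ℝ))) :
      Consistent w .scan (w.length + 1) d
  | pow {d : ℝ × ℝ × ℝ} (i j u : ℕ)
      (hd : d = ((u - 8 ^ j : ℝ), -(8 * u : ℝ), (numeral code w - j : ℝ))) :
      Consistent w .pow i d
  | last {d : ℝ × ℝ × ℝ} (i j u : ℕ)
      (hd : d = ((u - 8 ^ (j + 1) : ℝ), -(p * u), (numeral code w - j : ℝ))) :
      Consistent w .last i d
  | fin {d : ℝ × ℝ × ℝ} (i j u : ℕ)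
      (hd : d = (2 * u + 1 - p * 8 ^ (j + 1), 0, (numeral code w - j : ℝ))) :
      Consistent w .fin i d

variable {code p} {w : List α}

lemma consistent_scan {j : ℕ} (hj : j ≤ w.length) {d : ℝ × ℝ × ℝ}
    (hd : d = (-(numeral code (w.take j) : ℝ), 0, 0)) : Consistent code p w .scan (j + 1) d := by
  rcases hj.lt_or_eq with hj | rfl
  · exact .scan j 0 hj (by simp [hd])
  · exact .edge 0 (by simp [hd])

lemma consistent_initial : Consistent code p w .scan 1 (0, 0, 0) :=
  consistent_scan (Nat.zero_le _) (by simp [numeral])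

lemma one_le_abs_or_of_eq_sub {x : ℝ} (u v : ℕ) (hx : x = u - v) {C : Prop} (hC : u = v → C) :
    1 ≤ |x| ∨ C := by
  by_cases huv : u = v
  exacts [.inr (hC huv), .inl (hx ▸ one_le_abs_natCast_sub huv)]

/-- A test that fails does so by at least `1`, as the tests completed before the phase `fin` have
integral discrepancies. -/
lemma Consistent.go {m q q' i d mv close e} (hc : Consistent code p w q i d)
    (hA : reaction code p q m (tape w i) = .go q' mv close e) :
    if close then 1 ≤ |(d + e).1| ∨ Consistent code p w q' (mv.apply i) (rotate 0 (d + e))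
    else Consistent code p w q' (mv.apply i) (d + e) := by
  rcases hc with ⟨j, u, hj, rfl⟩ | ⟨u, rfl⟩ | ⟨i, j, u, rfl⟩ | ⟨i, j, u, rfl⟩ | ⟨i, j, u, rfl⟩
  · rw [tape_succ_of_lt hj] at hA
    cases m <;> simp only [reaction, Action.go.injEq, reduceCtorEq] at hA <;>
      obtain ⟨rfl, rfl, rfl, rfl⟩ := hA
    · exact .scan j (u + 1) hj (by ext <;> push_cast <;> simp <;> ring)
    · refine one_le_abs_or_of_eq_sub u _ (add_zero _) fun hu => consistent_scan hj ?_
      rw [numeral_take_add_one hj, ← hu]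
      ext <;> simp [rotate]
      ring
  · rw [tape_length_add_one] at hA
    cases m <;> simp only [reaction, Action.go.injEq, reduceCtorEq] at hA <;>
      obtain ⟨rfl, rfl, rfl, rfl⟩ := hA
    · exact .edge (u + 1) (by ext <;> push_cast <;> simp; ring)
    · exact one_le_abs_or_of_eq_sub u _ (add_zero _) fun hu => .pow _ 0 0 (by simp [rotate, hu])
  · cases m <;> simp only [reaction, Action.go.injEq] at hA <;>
      obtain ⟨rfl, rfl, rfl, rfl⟩ := hA
    · exact .pow _ j (u + 1) (by ext <;> push_cast <;> simp <;> ring)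
    · exact one_le_abs_or_of_eq_sub u (8 ^ j) (by simp) fun hu =>
        .pow _ (j + 1) 0 (by ext <;> simp [rotate, hu] <;> ring)
    · exact one_le_abs_or_of_eq_sub u (8 ^ j) (by simp) fun hu =>
        .last _ j 0 (by ext <;> simp [rotate, hu]; ring)
  · cases m <;> simp only [reaction, Action.go.injEq, reduceCtorEq] at hA <;>
      obtain ⟨rfl, rfl, rfl, rfl⟩ := hA
    · exact .last _ j (u + 1) (by ext <;> push_cast <;> simp <;> ring)
    · exact one_le_abs_or_of_eq_sub u (8 ^ (j + 1)) (by simp) fun hu =>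
        .fin _ j 0 (by ext <;> simp [rotate, hu]; ring)
  · generalize tape w i = σ at hA
    cases m <;> cases σ <;> simp only [reaction, Action.go.injEq, reduceCtorEq] at hA <;>
      obtain ⟨rfl, rfl, rfl, rfl⟩ := hA <;>
      exact .fin _ j (u + 1) (by ext <;> push_cast <;> simp; ring)

lemma exists_closed_or_consistent {l : List Msg} {g : Ledger Phase}
    (h : (protocol code p).Path w l g) :
    (∃ x ∈ g.closed, 1 ≤ |x|) ∨ Consistent code p w g.q g.i g.d := by
  induction h with
  | nil => exact .inr consistent_initial
  | @snoc _ g _ _ _ close e _ hA ih =>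
    rcases ih with ⟨x, hx, h1⟩ | hc
    · refine .inl ⟨x, ?_, h1⟩
      cases close
      exacts [hx, List.mem_cons_of_mem _ hx]
    · have hgo := hc.go hA
      cases close
      · exact .inr hgo
      · exact hgo.imp_left fun h1 => ⟨_, List.mem_cons_self, h1⟩

lemma eq_fin_of_reaction_eq_finish {q : Phase} {m : Msg} {σ : TapeSymbol α}
    (h : reaction code p q m σ = .finish) : q = .fin := by
  cases q <;> cases m <;> cases σ <;> simp_all [reaction]

lemma exists_discrepancy {l : List Msg} {g : Ledger Phase}
    (hp : ∀ m : ℕ, 3 / 4 ≤ |2 * m + 1 - p * 8 ^ (numeral code w + 1)|)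
    (h : (protocol code p).Transcript w l g) : ∃ x ∈ g.discrepancies, 3 / 4 ≤ |x| := by
  obtain ⟨l, m, -, hl, hm⟩ := h
  rcases exists_closed_or_consistent hl with ⟨x, hx, h1⟩ | hc
  · exact ⟨x, by simp [Ledger.discrepancies, hx], by linarith⟩
  · rw [eq_fin_of_reaction_eq_finish hm] at hc
    rcases hc with _ | _ | _ | _ | ⟨_, j, u, hd⟩
    rw [Ledger.discrepancies, hd]
    by_cases hj : numeral code w = j
    · exact ⟨_, List.mem_cons_self, hj ▸ hp u⟩
    · exact ⟨numeral code w - j, by simp, by linarith [one_le_abs_natCast_sub hj]⟩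

lemma exists_transcript (m : ℕ) : ∃ l g, (protocol code p).Transcript w l g ∧
    ∀ r : Rates, g.evidence r =
      Real.cosh (r.lam * (2 * m + 1 - p * 8 ^ (numeral code w + 1))) := by
  obtain ⟨l, g, hl, hq, hi, hd, hclosed⟩ := attains_fin (code := code) (p := p) (w := w) m
  refine ⟨_, g, ⟨l, .sep, rfl, hl, ?_⟩, fun r => ?_⟩
  · rw [hq, hi, tape_length_add_one]
    rfl
  · have hprod : (g.closed.map fun x => Real.cosh (r.lam * x)).prod = 1 :=
      List.prod_eq_one (by simpa using fun x hx => by simp [hclosed x hx])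
    simp [Ledger.evidence, Ledger.discrepancies, hd, hprod]

end

end WeakIPS

open WeakIPS in
theorem theorem4_general {α : Type*} [Countable α] (L : Language α) (ε : ℝ) (hε : 0 < ε) :
    ∃ (V : WeakIPS.Verifier α) (P : V.Prover), V.IsSweeping ∧ V.IsWeakIPS P L ε := by
  obtain ⟨code, hcode⟩ := exists_injective_nat α
  obtain ⟨p, hmem, hnot⟩ := exists_encoding (numeral code '' L)
  obtain ⟨r, hnear, hfar⟩ := exists_rates hε
  refine ⟨(protocol code p).verifier r, ?_⟩
  suffices hP : ∃ P, ((protocol code p).verifier r).IsWeakIPS P L ε from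
    hP.imp fun P hP => ⟨Protocol.isSweeping_verifier, hP⟩
  refine Protocol.exists_isWeakIPS hε.le (fun w hw => ?_) (fun w hw l g hg => ?_)
  · obtain ⟨m, hm⟩ := hmem _ (Set.mem_image_of_mem _ hw)
    obtain ⟨l, g, hg, hev⟩ := exists_transcript (code := code) (p := p) (w := w) m
    exact ⟨l, g, hg, Ledger.probReject_le (hev r ▸ hnear _ hm)⟩
  · have hp := hnot _ fun h => hw ((numeral_injective hcode).mem_set_image.1 h)
    obtain ⟨x, hx, hlarge⟩ := exists_discrepancy hp hg
    exact Ledger.le_probReject hε.le hx (hfar x hlarge)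

theorem theorem4 {α : Type*} [Finite α] (L : Language α) (ε : ℝ) (hε₀ : 0 < ε) (hε : ε < 1 / 2) :
    ∃ (V : WeakIPS.Verifier α) (P : V.Prover), V.IsSweeping ∧ V.IsWeakIPS P L ε :=
  theorem4_general L ε hε₀
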